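/- For integers $n,m\ge 0$ let $$\operatorname{Sing}_{n,m}=\Bigl\{(A_1,\dots,A_m)\in(\mathbb C^{n\times n})^m \;:\; \det\Bigl(\sum_{k=1}^m\lambda_kA_k\Bigr)=0\text{ for all }\lambda\in\mathbb Q^m\Bigr\},$$ and let $I_{n,m}\subseteq\mathbb C[x_{ij}^{(k)} : 1\le i,j\le n,\ 1\le k\le m]$ be the ideal of all polynomials vanishing on $\operatorname{Sing}_{n,m}$. Say that an ideal $I$ of a polynomial ring is generated in degree at most $d$ if $I$ is generated, as an ideal, by its homogeneous elements of degree at most $d$. Let $n,d\ge 0$ be integers. Then the ideals $I_{n,m}$ are generated in degree at most $d$ for all $m\ge 0$ if and only if $I_{n,n^2}$ is generated in degree at most $d$. Moreover, the generation degree is constant from $m=n^2$ on: for every $m\ge n^2$, the ideal $I_{n,m}$ is generated in degree at most $d$ if and only if $I_{n,n^2}$ is. -/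

import Mathlib

/-- `Sing_{n,m}`: the `m`-tuples of complex `n × n` matrices all of whose rational linear
combinations are singular. -/
def Sing (n m : ℕ) : Set (Fin m → Matrix (Fin n) (Fin n) ℂ) :=
  {A | ∀ c : Fin m → ℚ, (∑ k, (c k : ℂ) • A k).det = 0}

/-- Indices of the coordinates `x_{ij}^{(k)}`, written as `(k, i, j)`. -/
abbrev TensorIndex (n m : ℕ) : Type := Fin m × Fin n × Fin n

/-- The tuple of matrices with entries `x_{ij}^{(k)} = x (k, i, j)`. -/
def slices {n m : ℕ} (x : TensorIndex n m → ℂ) : Fin m → Matrix (Fin n) (Fin n) ℂ :=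
  fun k => Matrix.of fun i j => x (k, i, j)

/-- `I_{n,m}`: the ideal of all polynomials over `ℂ` in the `m n²` variables `x_{ij}^{(k)}`
that vanish at every point of `Sing_{n,m}`. -/
noncomputable def singIdeal (n m : ℕ) : Ideal (MvPolynomial (TensorIndex n m) ℂ) :=
  MvPolynomial.vanishingIdeal ℂ {x : TensorIndex n m → ℂ | slices x ∈ Sing n m}

/-- An ideal of a polynomial ring is generated in degree at most `d` if it is the ideal
generated by its homogeneous elements of degree at most `d`. -/
def IsGeneratedInDegreeLE {σ R : Type*} [CommSemiring R] (I : Ideal (MvPolynomial σ R))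
    (d : ℕ) : Prop :=
  Ideal.span {f | f ∈ I ∧ ∃ e ≤ d, f.IsHomogeneous e} = I

open MvPolynomial Matrix
open scoped ComplexConjugate Kronecker Nat

/-! This is Weyl's polarization argument. An `m`-tuple of `n × n` matrices is an `m × n²` matrix, so
its rank is at most `n²` and it is fixed by some `P * R` factoring through `ℂ^(n²)`. By
`mem_span_linSubst`, any `f` in `I_{n,m}` is then a combination of its substitutions along such
products. Each one first moves `f` into `I_{n,n²}`, where low-degree generators suffice, then moves
it back by a substitution preserving degrees and vanishing. The spanning statement rests on the
Fischer inner product, for which substitution along `S` has adjoint substitution along `Sᴴ`. -/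

/-- The linear substitution `x_i ↦ ∑ j, S i j x_j`. -/
noncomputable def linSubst {σ τ : Type*} [Fintype τ] (S : Matrix σ τ ℂ) :
    MvPolynomial σ ℂ →ₐ[ℂ] MvPolynomial τ ℂ :=
  aeval fun i => ∑ j, C (S i j) * X j

/-! ### Linear substitutions -/

section LinSubst

variable {σ τ υ : Type*} [Fintype τ] [Fintype υ]

theorem linSubst_X (S : Matrix σ τ ℂ) (i : σ) : linSubst S (X i) = ∑ j, C (S i j) * X j := by
  simp [linSubst]

theorem eval_linSubst (S : Matrix σ τ ℂ) (y : τ → ℂ) (f : MvPolynomial σ ℂ) :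
    eval y (linSubst S f) = eval (S *ᵥ y) f := by
  induction f using MvPolynomial.induction_on with
  | C a => simp [linSubst]
  | add p q hp hq => simp [hp, hq]
  | mul_X p i hp => simp [hp, linSubst_X, mulVec, dotProduct]

theorem linSubst_linSubst (S : Matrix σ τ ℂ) (T : Matrix τ υ ℂ) (f : MvPolynomial σ ℂ) :
    linSubst T (linSubst S f) = linSubst (S * T) f :=
  MvPolynomial.funext fun x => by simp [eval_linSubst]

theorem linSubst_one [Fintype σ] [DecidableEq σ] (f : MvPolynomial σ ℂ) : linSubst 1 f = f :=
  MvPolynomial.funext fun x => by simp [eval_linSubst]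

theorem MvPolynomial.IsHomogeneous.linSubst {f : MvPolynomial σ ℂ} {e : ℕ}
    (hf : f.IsHomogeneous e) (S : Matrix σ τ ℂ) : (linSubst S f).IsHomogeneous e := by
  have := hf.aeval (fun i => ∑ j, C (S i j) * X j) (n := 1) fun i =>
    IsHomogeneous.sum _ _ _ fun j _ => by
      simpa using (isHomogeneous_C τ (S i j)).mul (isHomogeneous_X ℂ j)
  simpa [_root_.linSubst] using this

theorem totalDegree_linSubst_le (S : Matrix σ τ ℂ) (f : MvPolynomial σ ℂ) :
    (linSubst S f).totalDegree ≤ f.totalDegree := by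
  conv_lhs => rw [← sum_homogeneousComponent f, map_sum]
  refine (totalDegree_finsetSum _ _).trans (Finset.sup_le fun e he => ?_)
  exact ((homogeneousComponent_isHomogeneous e f).linSubst S).totalDegree_le.trans
    (by simpa [Nat.lt_succ_iff] using he)

theorem pderiv_linSubst [Fintype σ] (S : Matrix σ τ ℂ) (j : τ) (f : MvPolynomial σ ℂ) :
    pderiv j (linSubst S f) = ∑ i, C (S i j) * linSubst S (pderiv i f) := by
  classical
  induction f using MvPolynomial.induction_on with
  | C a => simp [linSubst]
  | add p q hp hq => simp [hp, hq, mul_add, Finset.sum_add_distrib]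
  | mul_X p k hp =>
    have hd : pderiv j (linSubst S (X k)) = C (S k j) := by
      simp [linSubst_X, pderiv_X, Pi.single_apply]
    have hk : ∀ i, C (S i j) * linSubst S (pderiv i (p * X k)) =
        (if k = i then linSubst S p * C (S i j) else 0) +
          linSubst S (X k) * (C (S i j) * linSubst S (pderiv i p)) := by
      intro i
      rw [Derivation.leibniz, smul_eq_mul, smul_eq_mul, map_add, map_mul, map_mul]
      by_cases h : k = i
      · subst h
        rw [pderiv_X_self, map_one, if_pos rfl]
        ring
      · rw [pderiv_X_of_ne h, map_zero, if_neg h]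
        ring
    rw [map_mul, Derivation.leibniz, smul_eq_mul, smul_eq_mul, hp, hd,
      Finset.sum_congr rfl fun i _ => hk i, Finset.sum_add_distrib, Finset.sum_ite_eq,
      if_pos (Finset.mem_univ k), Finset.mul_sum]

end LinSubst

/-! ### The Fischer inner product and spanning by substitutions -/

section Fischer

variable {σ τ : Type*} [Fintype σ] [Fintype τ]

/-- The Fischer inner product `∑ α, α! * conj (coeff α f) * coeff α g`. -/
noncomputable def fischer (f g : MvPolynomial σ ℂ) : ℂ :=
  ∑ α ∈ f.support, ((∏ i, (α i)! : ℕ) : ℂ) * (conj (coeff α f) * coeff α g)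

theorem fischer_eq_sum (f g : MvPolynomial σ ℂ) {s : Finset (σ →₀ ℕ)} (hs : f.support ⊆ s) :
    fischer f g = ∑ α ∈ s, ((∏ i, (α i)! : ℕ) : ℂ) * (conj (coeff α f) * coeff α g) :=
  Finset.sum_subset hs fun α _ hα => by simp [notMem_support_iff.mp hα]

theorem conj_fischer (f g : MvPolynomial σ ℂ) : conj (fischer g f) = fischer f g := by
  classical
  rw [fischer_eq_sum f g (Finset.subset_union_left (s₂ := g.support)),
    fischer_eq_sum g f (Finset.subset_union_right (s₁ := f.support)), map_sum]
  refine Finset.sum_congr rfl fun α _ => ?_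
  simp only [map_mul, Complex.conj_conj, map_natCast]
  ring

theorem fischer_add_right (f g h : MvPolynomial σ ℂ) :
    fischer f (g + h) = fischer f g + fischer f h := by
  simp [fischer, mul_add, Finset.sum_add_distrib]

theorem fischer_C_mul_right (a : ℂ) (f g : MvPolynomial σ ℂ) :
    fischer f (C a * g) = a * fischer f g := by
  simp only [fischer, coeff_C_mul, Finset.mul_sum]
  exact Finset.sum_congr rfl fun α _ => by ring

theorem fischer_add_left (f g h : MvPolynomial σ ℂ) :
    fischer (f + g) h = fischer f h + fischer g h := by
  simp only [← conj_fischer _ h, fischer_add_right, map_add]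

theorem fischer_C_mul_left (a : ℂ) (f g : MvPolynomial σ ℂ) :
    fischer (C a * f) g = conj a * fischer f g := by
  simp only [← conj_fischer _ g, fischer_C_mul_right, map_mul]

theorem fischer_sum_left {ι : Type*} (s : Finset ι) (f : ι → MvPolynomial σ ℂ)
    (g : MvPolynomial σ ℂ) : fischer (∑ i ∈ s, f i) g = ∑ i ∈ s, fischer (f i) g := by
  classical
  induction s using Finset.induction_on with
  | empty => simp [fischer]
  | insert a s ha ih => rw [Finset.sum_insert ha, Finset.sum_insert ha, fischer_add_left, ih]

theorem fischer_sum_right {ι : Type*} (s : Finset ι) (f : MvPolynomial σ ℂ)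
    (g : ι → MvPolynomial σ ℂ) : fischer f (∑ i ∈ s, g i) = ∑ i ∈ s, fischer f (g i) := by
  simp only [← conj_fischer f, fischer_sum_left, map_sum]

theorem fischer_monomial_left (α : σ →₀ ℕ) (a : ℂ) (g : MvPolynomial σ ℂ) :
    fischer (monomial α a) g = ((∏ i, (α i)! : ℕ) : ℂ) * (conj a * coeff α g) := by
  classical
  rw [fischer_eq_sum _ _ support_monomial_subset, Finset.sum_singleton, coeff_monomial, if_pos rfl]

theorem fischer_C_left (a : ℂ) (g : MvPolynomial σ ℂ) :
    fischer (C a) g = conj a * constantCoeff g := by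
  rw [← monomial_zero', fischer_monomial_left]
  simp [constantCoeff_eq]

/-- The factorial weights are chosen so that multiplication by a variable is adjoint to
differentiation. -/
theorem fischer_mul_X_left (f g : MvPolynomial σ ℂ) (i : σ) :
    fischer (f * X i) g = fischer f (pderiv i g) := by
  classical
  induction f using MvPolynomial.induction_on' with
  | add p q hp hq => rw [add_mul, fischer_add_left, fischer_add_left, hp, hq]
  | monomial α a =>
    have hw : ∏ j, ((α + Finsupp.single i 1 : σ →₀ ℕ) j)! = (α i + 1) * ∏ j, (α j)! := by
      have : ∀ j, ((α + Finsupp.single i 1 : σ →₀ ℕ) j)! = (if i = j then α j + 1 else 1) * (α j)! := by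
        intro j
        by_cases h : i = j <;> simp [h, Nat.factorial_succ]
      rw [Finset.prod_congr rfl fun j _ => this j, Finset.prod_mul_distrib, Finset.prod_ite_eq,
        if_pos (Finset.mem_univ i)]
    rw [X, monomial_mul, mul_one, fischer_monomial_left, fischer_monomial_left, coeff_pderiv, hw]
    push_cast
    ring

/-- Induction on `f`: each variable crosses the pairing as a derivative, and the chain rule supplies
the entries of `Sᴴ`. -/
theorem fischer_linSubst_left (S : Matrix σ τ ℂ) (f : MvPolynomial σ ℂ) (g : MvPolynomial τ ℂ) :
    fischer (linSubst S f) g = fischer f (linSubst Sᴴ g) := by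
  induction f using MvPolynomial.induction_on generalizing g with
  | C a =>
    have h0 : constantCoeff (linSubst Sᴴ g) = constantCoeff g := by
      simp [← eval_zero, eval_linSubst]
    rw [show linSubst S (C a) = C a by simp [linSubst], fischer_C_left, fischer_C_left, h0]
  | add p q hp hq => rw [map_add, fischer_add_left, fischer_add_left, hp, hq]
  | mul_X p i hp =>
    rw [map_mul, linSubst_X, Finset.mul_sum, fischer_sum_left, fischer_mul_X_left, pderiv_linSubst,
      fischer_sum_right]
    refine Finset.sum_congr rfl fun j _ => ?_
    rw [mul_left_comm, fischer_C_mul_left, fischer_mul_X_left, hp, fischer_C_mul_right]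
    simp

theorem fischer_self (f : MvPolynomial σ ℂ) :
    fischer f f = ((∑ α ∈ f.support, (∏ i, (α i)! : ℕ) * ‖coeff α f‖ ^ 2 : ℝ) : ℂ) := by
  simp [fischer, Complex.conj_mul']

/-- The Fischer inner product makes polynomials an inner product space. -/
noncomputable abbrev fischerCore (σ : Type*) [Fintype σ] :
    InnerProductSpace.Core ℂ (MvPolynomial σ ℂ) where
  inner := fischer
  conj_inner_symm := conj_fischer
  re_inner_nonneg f := by
    change 0 ≤ (fischer f f).re
    rw [fischer_self, Complex.ofReal_re]
    positivity
  add_left := fischer_add_left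
  smul_left f g a := by
    change fischer (a • f) g = conj a * fischer f g
    rw [smul_eq_C_mul, fischer_C_mul_left]
  definite f hf := by
    change fischer f f = 0 at hf
    rw [fischer_self, Complex.ofReal_eq_zero, Finset.sum_eq_zero_iff_of_nonneg
      (fun α _ => by positivity)] at hf
    ext α
    by_contra h
    have h1 := hf α (mem_support_iff.mpr h)
    have h2 : (∏ i, (α i)!) ≠ 0 := Finset.prod_ne_zero_iff.mpr fun i _ => Nat.factorial_ne_zero _
    rw [mul_eq_zero, Nat.cast_eq_zero, pow_eq_zero_iff two_ne_zero, norm_eq_zero] at h1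
    exact h1.elim h2 h

theorem exists_add_fischer_orthogonal (U : Submodule ℂ (MvPolynomial σ ℂ))
    [FiniteDimensional ℂ U] (f : MvPolynomial σ ℂ) :
    ∃ u ∈ U, ∃ g, (∀ v ∈ U, fischer v g = 0) ∧ f = u + g := by
  let : NormedAddCommGroup (MvPolynomial σ ℂ) := (fischerCore σ).toNormedAddCommGroup
  let : InnerProductSpace ℂ (MvPolynomial σ ℂ) := InnerProductSpace.ofCore (fischerCore σ).toCore
  obtain ⟨u, hu, g, hg, h⟩ := U.exists_add_mem_mem_orthogonal f
  exact ⟨u, hu, g, fun v hv => hg v hv, h⟩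

/-- If every point is fixed by some element of a right ideal of matrices, then every
polynomial is a linear combination of its linear substitutions by elements of that ideal. -/
theorem mem_span_linSubst (T : Set (Matrix σ σ ℂ)) (hT : ∀ S ∈ T, ∀ R, R ∈ T → S * R ∈ T)
    (hT' : ∀ S ∈ T, Sᴴ ∈ T) (hx : ∀ x : σ → ℂ, ∃ S ∈ T, S *ᵥ x = x) (f : MvPolynomial σ ℂ) :
    f ∈ Submodule.span ℂ ((fun S => linSubst S f) '' T) := by
  set U := Submodule.span ℂ ((fun S => linSubst S f) '' T) with hU
  -- Bounded degree makes `U` finite-dimensional, so orthogonal projection onto it exists.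
  have hle : U ≤ restrictTotalDegree σ ℂ f.totalDegree := by
    rw [hU, Submodule.span_le]
    rintro _ ⟨S, -, rfl⟩
    exact (mem_restrictTotalDegree _ _ _).mpr (totalDegree_linSubst_le S f)
  have : FiniteDimensional ℂ U := Submodule.finiteDimensional_of_le hle
  have hstab : ∀ S ∈ T, ∀ u ∈ U, linSubst S u ∈ U := by
    intro S hS u hu
    induction hu using Submodule.span_induction with
    | mem _ h =>
      obtain ⟨R, hR, rfl⟩ := h
      exact Submodule.subset_span ⟨R * S, hT R hR S hS, (linSubst_linSubst R S f).symm⟩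
    | zero => simp
    | add p q _ _ hp hq => simpa using U.add_mem hp hq
    | smul a p _ hp => simpa using U.smul_mem a hp
  obtain ⟨u, hu, g, hg, h⟩ := exists_add_fischer_orthogonal U f
  -- `linSubst S g` lies in `U`; moving one `S` across its pairing with itself leaves an element of
  -- `U` paired with `g`, which is zero.
  have hgS : ∀ S ∈ T, linSubst S g = 0 := by
    intro S hS
    have hmem : linSubst S g ∈ U := by
      have : linSubst S g = linSubst S f - linSubst S u := by rw [h]; simp
      rw [this]
      exact U.sub_mem (Submodule.subset_span ⟨S, hS, rfl⟩) (hstab S hS u hu)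
    refine (fischerCore σ).definite _ ?_
    change fischer (linSubst S g) (linSubst S g) = 0
    rw [← conj_fischer, ← conjTranspose_conjTranspose S, ← fischer_linSubst_left,
      hg _ (hstab _ (hT' S hS) _ (by simpa using hmem)), map_zero]
  have hg0 : g = 0 := MvPolynomial.funext fun x => by
    obtain ⟨S, hS, hSx⟩ := hx x
    rw [← hSx, ← eval_linSubst, hgS S hS, map_zero, map_zero]
  rw [h, hg0, add_zero]
  exact hu

end Fischer

/-- `B` extends a linear section of `A` over its range to the whole space. -/
theorem Matrix.exists_mul_mul_self_eq {K m n : Type*} [Field K] [Fintype m] [Fintype n]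
    (A : Matrix m n K) : ∃ B : Matrix n m K, A * B * A = A := by
  classical
  obtain ⟨s, hs⟩ := A.toLin'.rangeRestrict.exists_rightInverse_of_surjective
    A.toLin'.range_rangeRestrict
  obtain ⟨t, ht⟩ := s.exists_extend
  refine ⟨LinearMap.toMatrix' t, toLin'.injective (LinearMap.ext fun v => ?_)⟩
  have h1 : t (A.toLin' v) = s (A.toLin'.rangeRestrict v) := 
    LinearMap.congr_fun ht (A.toLin'.rangeRestrict v)
  have h2 := congrArg Subtype.val (LinearMap.congr_fun hs (A.toLin'.rangeRestrict v))
  simp only [toLin'_mul, toLin'_toMatrix', LinearMap.comp_apply, h1]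
  exact h2

/-! ### Polarization for the ideals of `Sing` -/

section Sing

variable {n : ℕ}

/-- The matrix by which `P` acts on tuples of `n × n` matrices. -/
noncomputable def tensorMat (n : ℕ) {ι κ : Type*} (P : Matrix ι κ ℂ) :
    Matrix (ι × Fin n × Fin n) (κ × Fin n × Fin n) ℂ :=
  P ⊗ₖ (1 : Matrix (Fin n × Fin n) (Fin n × Fin n) ℂ)

theorem tensorMat_mul {ι κ μ : Type*} [Fintype κ] (P : Matrix ι κ ℂ) (Q : Matrix κ μ ℂ) :
    tensorMat n P * tensorMat n Q = tensorMat n (P * Q) := by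
  rw [tensorMat, tensorMat, tensorMat, ← mul_kronecker_mul, one_mul]

theorem tensorMat_one {ι : Type*} [DecidableEq ι] :
    tensorMat n (1 : Matrix ι ι ℂ) = 1 := one_kronecker_one

theorem conjTranspose_tensorMat {ι κ : Type*} (P : Matrix ι κ ℂ) :
    (tensorMat n P)ᴴ = tensorMat n Pᴴ := by
  rw [tensorMat, tensorMat, conjTranspose_kronecker, conjTranspose_one]

theorem tensorMat_mulVec_apply {ι κ : Type*} [Fintype κ] (P : Matrix ι κ ℂ)
    (x : κ × Fin n × Fin n → ℂ) (k : ι) (q : Fin n × Fin n) :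
    (tensorMat n P *ᵥ x) (k, q) = ∑ l, P k l * x (l, q) := by
  simp [tensorMat, mulVec, dotProduct, kroneckerMap_apply, Fintype.sum_prod_type (α₁ := κ),
    one_apply]

theorem slices_tensorMat_mulVec {m m' : ℕ} (P : Matrix (Fin m') (Fin m) ℂ)
    (x : TensorIndex n m → ℂ) (k : Fin m') :
    slices (tensorMat n P *ᵥ x) k = ∑ l, P k l • slices x l := by
  ext i j
  simp [slices, tensorMat_mulVec_apply, Matrix.sum_apply]

/-- Rational linear combinations may be replaced by complex ones in the definition of `Sing`. -/
theorem det_sum_smul_eq_zero {m : ℕ} {A : Fin m → Matrix (Fin n) (Fin n) ℂ} (hA : A ∈ Sing n m)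
    (c : Fin m → ℂ) : (∑ k, c k • A k).det = 0 := by
  let M : Matrix (Fin n) (Fin n) (MvPolynomial (Fin m) ℂ) := ∑ k, (X k : MvPolynomial (Fin m) ℂ) • (A k).map C
  have hM : ∀ c : Fin m → ℂ, eval c M.det = (∑ k, c k • A k).det := by
    intro c
    rw [RingHom.map_det]
    congr 1
    ext i j
    simp [M, Matrix.sum_apply]
  -- A polynomial vanishing on the infinite grid `ℚ^m` is zero.
  have h0 : M.det = 0 := by
    refine funext_set (fun _ => Set.range ((↑) : ℚ → ℂ))
      (fun _ => Set.infinite_range_of_injective Rat.cast_injective) fun x hx => ?_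
    choose q hq using fun k : Fin m => hx k (Set.mem_univ k)
    rw [hM, map_zero, ← hA q]
    simp [hq]
  rw [← hM, h0, map_zero]

theorem slices_tensorMat_mem_Sing {m m' : ℕ} (P : Matrix (Fin m') (Fin m) ℂ)
    {x : TensorIndex n m → ℂ} (hx : slices x ∈ Sing n m) :
    slices (tensorMat n P *ᵥ x) ∈ Sing n m' := by
  intro c
  rw [← det_sum_smul_eq_zero hx fun l => ∑ k, (c k : ℂ) * P k l]
  congr 1
  simp only [slices_tensorMat_mulVec, Finset.smul_sum, Finset.sum_smul, mul_smul]
  exact Finset.sum_comm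

theorem linSubst_mem_singIdeal {m m' : ℕ} (P : Matrix (Fin m') (Fin m) ℂ)
    {f : MvPolynomial (TensorIndex n m') ℂ} (hf : f ∈ singIdeal n m') :
    linSubst (tensorMat n P) f ∈ singIdeal n m := by
  rw [singIdeal, mem_vanishingIdeal_iff] at hf ⊢
  intro x hx
  have h := hf _ (slices_tensorMat_mem_Sing P hx)
  rw [aeval_eq_eval] at h ⊢
  exact (eval_linSubst _ _ _).trans h

/-- The ideal generated by the homogeneous elements of degree at most `d` of `I_{n,m}`. -/
noncomputable def lowSingIdeal (n m d : ℕ) : Ideal (MvPolynomial (TensorIndex n m) ℂ) :=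
  Ideal.span {f | f ∈ singIdeal n m ∧ ∃ e ≤ d, f.IsHomogeneous e}

theorem lowSingIdeal_le (n m d : ℕ) : lowSingIdeal n m d ≤ singIdeal n m :=
  Ideal.span_le.mpr fun _ h => h.1

theorem linSubst_mem_lowSingIdeal {m m' d : ℕ} (P : Matrix (Fin m') (Fin m) ℂ)
    {f : MvPolynomial (TensorIndex n m') ℂ} (hf : f ∈ lowSingIdeal n m' d) :
    linSubst (tensorMat n P) f ∈ lowSingIdeal n m d := by
  suffices lowSingIdeal n m' d ≤
      (lowSingIdeal n m d).comap (linSubst (tensorMat n P)) from this hf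
  refine Ideal.span_le.mpr ?_
  rintro g ⟨hg, e, he, hge⟩
  exact Ideal.subset_span ⟨linSubst_mem_singIdeal P hg, e, he, hge.linSubst _⟩

theorem isGeneratedInDegreeLE_of_sq {d : ℕ}
    (h : IsGeneratedInDegreeLE (singIdeal n (n ^ 2)) d) (m : ℕ) :
    IsGeneratedInDegreeLE (singIdeal n m) d := by
  refine (lowSingIdeal_le n m d).antisymm fun f hf => ?_
  let T : Set (Matrix (TensorIndex n m) (TensorIndex n m) ℂ) :=
    {S | ∃ (P : Matrix (Fin m) (Fin (n ^ 2)) ℂ) (R : Matrix (Fin (n ^ 2)) (Fin m) ℂ),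
      tensorMat n (P * R) = S}
  have hspan := mem_span_linSubst T ?_ ?_ ?_ f
  · have hle : Submodule.span ℂ ((fun S => linSubst S f) '' T) ≤
        (lowSingIdeal n m d).restrictScalars ℂ := by
      rw [Submodule.span_le]
      rintro _ ⟨_, ⟨P, R, rfl⟩, rfl⟩
      change linSubst (tensorMat n (P * R)) f ∈ lowSingIdeal n m d
      rw [← tensorMat_mul, ← linSubst_linSubst]
      refine linSubst_mem_lowSingIdeal R ?_
      have h' : lowSingIdeal n (n ^ 2) d = singIdeal n (n ^ 2) := h
      rw [h']
      exact linSubst_mem_singIdeal P hf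
    exact hle hspan
  · rintro _ ⟨P, R, rfl⟩ _ ⟨P', R', rfl⟩
    exact ⟨P, R * (P' * R'), by rw [tensorMat_mul, Matrix.mul_assoc]⟩
  · rintro _ ⟨P, R, rfl⟩
    exact ⟨Rᴴ, Pᴴ, by rw [conjTranspose_tensorMat, conjTranspose_mul]⟩
  · intro x
    let e : Fin (n ^ 2) ≃ Fin n × Fin n := (finCongr (sq n)).trans finProdFinEquiv.symm
    -- Flattened, `x` is the matrix `A`, on which the tuple action is left multiplication; `A * B *
    -- A = A` says that `A * B` fixes `x`.
    let A : Matrix (Fin m) (Fin (n ^ 2)) ℂ := Matrix.of fun k q => x (k, e q)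
    obtain ⟨B, hB⟩ := A.exists_mul_mul_self_eq
    refine ⟨_, ⟨A, B, rfl⟩, funext fun ⟨k, q⟩ => ?_⟩
    have := congrFun (congrFun hB k) (e.symm q)
    rw [Matrix.mul_apply] at this
    simpa [tensorMat_mulVec_apply, A] using this

theorem IsGeneratedInDegreeLE.singIdeal_mono {m m' d : ℕ} (hm : m' ≤ m)
    (h : IsGeneratedInDegreeLE (singIdeal n m) d) :
    IsGeneratedInDegreeLE (singIdeal n m') d := by
  refine (lowSingIdeal_le n m' d).antisymm fun f hf => ?_
  -- Truncation to the first `m'` slices; `Pᵀ` pads with zeros, so `P * Pᵀ = 1` recovers `f` from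
  -- its image in `I_{n,m}`.
  let P : Matrix (Fin m') (Fin m) ℂ := (1 : Matrix (Fin m) (Fin m) ℂ).submatrix (Fin.castLE hm) id
  have hP : P * Pᵀ = 1 := by
    ext i j
    simp [P, Matrix.mul_apply, one_apply, Finset.sum_ite_eq']
  have h' : lowSingIdeal n m d = singIdeal n m := h
  have := linSubst_mem_lowSingIdeal Pᵀ (h' ▸ linSubst_mem_singIdeal P hf)
  rwa [linSubst_linSubst, tensorMat_mul, hP, tensorMat_one, linSubst_one] at this

end Sing

theorem corollary4p5 (n d : ℕ) :
    ((∀ m : ℕ, IsGeneratedInDegreeLE (singIdeal n m) d) ↔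
      IsGeneratedInDegreeLE (singIdeal n (n ^ 2)) d) ∧
    (∀ m : ℕ, n ^ 2 ≤ m →
      (IsGeneratedInDegreeLE (singIdeal n m) d ↔
        IsGeneratedInDegreeLE (singIdeal n (n ^ 2)) d)) := by
  exact ⟨⟨fun h => h _, isGeneratedInDegreeLE_of_sq⟩, fun m hm =>
    ⟨fun h => h.singIdeal_mono hm, fun h => isGeneratedInDegreeLE_of_sq h m⟩⟩
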